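/- Theorem (Failure of Multinomial Bootstrap). Let $\Theta$ be an item space with integrating measure $d\theta$ and supply $s\in L^\infty_+$, $\int s\,d\theta=1$; write $\mathbb E[g]=\int g\,s\,d\theta$ and $\operatorname{Var}[g]=\mathbb E[g^2]-(\mathbb E[g])^2$. Consider a first-price pacing equilibrium (FPPE) with a single buyer with budget $b_1=1$ and a bounded valuation $v_1\in L^1_+$ with $\mathbb E[v_1]=1$ and $\operatorname{Var}[v_1]>0$. A limit FPPE is a multiplier $\beta\in[0,1]$ with prices $p=\beta v_1\in L^1_+$ for which there is an allocation $x:\Theta\to[0,1]$, with $x=1$ wherever $p>0$, such that $\mathrm{pay}=\int x\,p\,s\,d\theta\le b_1$, and $\beta=1$ if $\mathrm{pay}<b_1$. The finite FPPE of items $\theta^1,\dots,\theta^t$ is the same notion with $s\,d\theta$ replaced by mass $1/t$ on each item. Let $\beta^*$ be the limit multiplier; let $\theta^1,\theta^2,\dots$ be i.i.d. with density $s$, and $\beta^\gamma$ the multiplier of the finite FPPE of $\theta^1,\dots,\theta^t$. Let $\theta^{1,b},\dots,\theta^{t,b}$ be $t$ uniform draws with replacement from $\theta^1,\dots,\theta^t$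 (the draws of indices being independent of the data), and $$\beta^b=\operatorname*{arg\,min}_{\beta\in(0,1]}\ \frac1t\sum_{\tau=1}^t \beta\, v_1(\theta^{\tau,b})-b_1\log\beta .$$ Then: (i) the buyer is degenerate: $\beta^*=1$ and the leftover budget $b_1-\mathrm{pay}$ is $0$; (ii) $\sqrt t(\beta^\gamma-\beta^*)$ converges in distribution to $\mathcal J=\min\{Z,0\}$, where $Z\sim N(0,\operatorname{Var}[v_1])$; (iii) the conditional distribution of $\sqrt t(\beta^b-\beta^\gamma)$ given the data does not consistently estimate $\mathcal J$: with $\mathrm{BL}_1$ the set of $1$-Lipschitz functions $f:\mathbb R\to[-1,1]$, the quantity $$\Delta_t=\sup_{f\in \mathrm{BL}_1}\Big|\mathbb E\big[f(\sqrt t(\beta^b-\beta^\gamma))\,\big|\,\theta^1,\dots,\theta^t\big]-\mathbb E[f(\mathcal J)]\Big|$$ (computed with the regular conditional distribution) does not converge to $0$ in probability; moreover, for almost every realization of the data, $\Delta_t$ does not converge to $0$. -/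

import Mathlib

open MeasureTheory ProbabilityTheory Filter Topology
open scoped ENNReal

/-- The data shared by all equilibrium notions: buyers `ι`, an item space `Θ` with its integrating
measure `dθ` (here `base`), budgets, bounded valuations `v i ∈ L¹₊(dθ)`, and a supply
`s ∈ L^∞₊(dθ)` of total mass one. -/
structure AuctionMarket (ι Θ : Type*) [MeasurableSpace Θ] where
  base : Measure Θ
  budget : ι → ℝ
  budget_pos : ∀ i, 0 < budget i
  value : ι → Θ → ℝ
  value_measurable : ∀ i, Measurable (value i)
  value_nonneg : ∀ i θ, 0 ≤ value i θ
  value_integrable : ∀ i, Integrable (value i) base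
  value_bounded : ∃ C, ∀ i θ, value i θ ≤ C
  supply : Θ → ℝ
  supply_measurable : Measurable supply
  supply_nonneg : ∀ θ, 0 ≤ supply θ
  supply_memLp : MemLp supply ∞ base
  supply_total : ∫ θ, supply θ ∂base = 1

namespace AuctionMarket

variable {ι Θ : Type*} [MeasurableSpace Θ]

/-- `E[g] = ∫ g s dθ`. -/
noncomputable def expect (M : AuctionMarket ι Θ) (g : Θ → ℝ) : ℝ :=
  ∫ θ, g θ * M.supply θ ∂M.base

/-- `Var[g] = E[g²] - (E[g])²`. -/
noncomputable def variance (M : AuctionMarket ι Θ) (g : Θ → ℝ) : ℝ :=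
  M.expect (fun θ => g θ ^ 2) - (M.expect g) ^ 2

/-- The law of one item drawn from the supply: the measure `s dθ`. -/
noncomputable def itemLaw (M : AuctionMarket ι Θ) : Measure Θ :=
  M.base.withDensity (fun θ => ENNReal.ofReal (M.supply θ))

/-- The payment of a buyer who gets the fraction `xi θ` of each item at prices `p`. -/
noncomputable def pay (M : AuctionMarket ι Θ) (p xi : Θ → ℝ) : ℝ :=
  ∫ θ, xi θ * p θ * M.supply θ ∂M.base

/-- `(β, p)` is a limit first-price pacing equilibrium, supported by the allocation `x`. -/
structure IsLimitFPPEWith [Fintype ι] (M : AuctionMarket ι Θ) (β : ι → ℝ) (p : Θ → ℝ)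
    (x : ι → Θ → ℝ) : Prop where
  multiplier_mem : ∀ i, β i ∈ Set.Icc (0 : ℝ) 1
  price_integrable : Integrable p M.base
  alloc_measurable : ∀ i, Measurable (x i)
  alloc_mem : ∀ i θ, x i θ ∈ Set.Icc (0 : ℝ) 1
  first_price : ∀ θ, p θ = ⨆ i, β i * M.value i θ
  winner : ∀ i θ, 0 < x i θ → β i * M.value i θ = ⨆ k, β k * M.value k θ
  budget_feasible : ∀ i, M.pay p (x i) ≤ M.budget i
  no_overselling : ∀ θ, ∑ i, x i θ ≤ 1
  fully_allocated : ∀ θ, 0 < p θ → ∑ i, x i θ = 1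
  no_unnecessary_pacing : ∀ i, M.pay p (x i) < M.budget i → β i = 1

/-- Buyer `i` is degenerate: unpaced, with zero leftover budget `δ i = b i - pay i`. -/
def IsDegenerate (M : AuctionMarket ι Θ) (β : ι → ℝ) (p : Θ → ℝ) (x : ι → Θ → ℝ) (i : ι) : Prop :=
  β i = 1 ∧ M.budget i - M.pay p (x i) = 0

/-- `(β, p)` is a finite first-price pacing equilibrium for the `t` observed items `γ`, each
with supply `σ`. -/
def IsFiniteFPPE [Fintype ι] (M : AuctionMarket ι Θ) {t : ℕ} (σ : ℝ) (γ : Fin t → Θ)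
    (β : ι → ℝ) (p : Fin t → ℝ) : Prop :=
  (∀ i, β i ∈ Set.Icc (0 : ℝ) 1) ∧ (∀ τ, 0 ≤ p τ) ∧
  ∃ x : ι → Fin t → ℝ, (∀ i τ, x i τ ∈ Set.Icc (0 : ℝ) 1) ∧
    (∀ τ, p τ = ⨆ i, β i * M.value i (γ τ)) ∧
    (∀ i τ, 0 < x i τ → β i * M.value i (γ τ) = ⨆ k, β k * M.value k (γ τ)) ∧
    (∀ i, σ * ∑ τ, x i τ * p τ ≤ M.budget i) ∧
    (∀ τ, ∑ i, x i τ ≤ 1) ∧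
    (∀ τ, 0 < p τ → ∑ i, x i τ = 1) ∧
    (∀ i, σ * ∑ τ, x i τ * p τ < M.budget i → β i = 1)

/-- The sample dual Eisenberg-Gale objective
`(1/t) ∑ τ, (max_i β i v i (γ τ) - ∑ i, b i log (β i))`. -/
noncomputable def sampleEG [Fintype ι] (M : AuctionMarket ι Θ) {t : ℕ} (γ : Fin t → Θ)
    (β : ι → ℝ) : ℝ :=
  (1 / (t : ℝ)) * ∑ τ, ((⨆ i, β i * M.value i (γ τ)) - ∑ i, M.budget i * Real.log (β i))

/-- `β` minimizes the sample Eisenberg-Gale objective of the items `γ` over `(0,1]ⁿ`. -/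
def IsEGMinimizer [Fintype ι] (M : AuctionMarket ι Θ) {t : ℕ} (γ : Fin t → Θ)
    (β : ι → ℝ) : Prop :=
  β ∈ {β' : ι → ℝ | ∀ i, β' i ∈ Set.Ioc (0 : ℝ) 1} ∧
    IsMinOn (M.sampleEG γ) {β' : ι → ℝ | ∀ i, β' i ∈ Set.Ioc (0 : ℝ) 1} β

end AuctionMarket

/-- The first `t` terms of a sequence of random items. -/
def firstItems {Ω Θ : Type*} (θ : ℕ → Ω → Θ) (t : ℕ) (ω : Ω) : Fin t → Θ :=
  fun τ => θ τ ω

/-- `J t 0, …, J t (t-1)` are the indices of `t` uniform draws with replacement from the `t` data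
points, independent of the data. (The numbers of times that the indices are drawn
are then multinomial weights with probabilities `1/t`.) -/
structure IsMultinomialResampling {Ω Θ : Type*} [MeasurableSpace Ω] [MeasurableSpace Θ]
    (P : Measure Ω) (θ : ℕ → Ω → Θ) (J : (t : ℕ) → Fin t → Ω → Fin t) : Prop where
  uniform : ∀ t k, HasLaw (J t k) (uniformOn Set.univ) P
  indep_draws : ∀ t, iIndepFun (J t) P
  indep_data : ∀ t, IndepFun (firstItems θ t) (fun ω k => J t k ω) P

/-- The resampled items `θ^{1,b}, …, θ^{t,b}`. -/
def resampledItems {Ω Θ : Type*} (θ : ℕ → Ω → Θ) (J : (t : ℕ) → Fin t → Ω → Fin t)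
    (t : ℕ) (ω : Ω) : Fin t → Θ :=
  fun k => θ (J t k ω) ω

/-- The class `BL₁` of 1-Lipschitz functions bounded by 1. -/
def BLOne (E : Type*) [PseudoMetricSpace E] : Set (E → ℝ) :=
  {f | (∀ x, |f x| ≤ 1) ∧ ∀ x y, |f x - f y| ≤ dist x y}

/-- The bounded-Lipschitz distance `sup_{f ∈ BL₁} |∫ f dρ - ∫ f dL|`. -/
noncomputable def blDist {E : Type*} [PseudoMetricSpace E] [MeasurableSpace E]
    (ρ L : Measure E) : ℝ :=
  ⨆ f : BLOne E, |(∫ x, f.1 x ∂ρ) - ∫ x, f.1 x ∂L|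

/-- `sup_{f ∈ BL₁} |E[f(X) | data] - E_{X ∼ L}[f(X)]|`, through the regular conditional law of `X`
given the data. -/
noncomputable def condBLDist {Ω D E : Type*} [MeasurableSpace Ω] [MeasurableSpace D]
    [PseudoMetricSpace E] [MeasurableSpace E] [StandardBorelSpace E] [Nonempty E]
    (P : Measure Ω) [IsFiniteMeasure P] (data : Ω → D) (X : Ω → E) (L : Measure E) (ω : Ω) : ℝ :=
  blDist (condDistrib X data P (data ω)) L

/-- The conditional distribution of `X t` given `data t` consistently estimates `L`. -/
def ConditionallyConsistent {Ω E : Type*} {D : ℕ → Type*} [MeasurableSpace Ω]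
    [∀ t, MeasurableSpace (D t)]
    [PseudoMetricSpace E] [MeasurableSpace E] [StandardBorelSpace E] [Nonempty E]
    (P : Measure Ω) [IsFiniteMeasure P] (data : (t : ℕ) → Ω → D t) (X : ℕ → Ω → E)
    (L : Measure E) : Prop :=
  TendstoInMeasure P (fun t ω => condBLDist P (data t) (X t) L ω) atTop (fun _ => 0)

/-! With one buyer and unit budget, every multiplier is `1 / max m 1`, where `m` is the mean value
of the items. The limit mean is exactly 1, the kink of this function; the central limit theorem with
Slutsky's lemma then gives the half-normal limit.

The bootstrap fails because of the kink. If the data total lies below `t` by `K √t`, then the data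
multiplier is 1, and a resample moves it only by overshooting its own centre by at least `K √t`.
Resampled totals have variance at most `t C²`, so the truncated deviation has conditional mean at
least `-C²/(4K)`, while under the half-normal law the same test function has a fixed negative mean.
For large `K` the bounded-Lipschitz distance therefore stays above some `δ > 0` on such data
(`exists_le_condBLDist_bootstrapDeviation`).

Such undershoots have probability bounded below, which excludes convergence in probability. By
Kolmogorov's 0-1 law they almost surely recur infinitely often (`ae_frequently_sum_lt_mul_sqrt`),
which excludes convergence along almost every realization. -/

/-! ### Events occurring infinitely often, and the 0-1 law for partial sums. -/

theorem measurableSet_frequently {Ω : Type*} [MeasurableSpace Ω] {p : ℕ → Ω → Prop}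
    (hp : ∀ n, MeasurableSet {ω | p n ω}) : MeasurableSet {ω | ∃ᶠ n in atTop, p n ω} := by
  simp only [frequently_atTop]
  have : {ω | ∀ a, ∃ b, b ≥ a ∧ p b ω} = ⋂ a, ⋃ b, ⋃ (_ : b ≥ a), {ω | p b ω} := by
    ext ω; simp
  rw [this]
  exact MeasurableSet.iInter fun a => MeasurableSet.iUnion fun b => MeasurableSet.iUnion fun _ => hp b

/-- Continuity from above: the limsup event is the decreasing intersection of tail unions, each of
mass at least `c`. -/
theorem le_measure_frequently {Ω : Type*} [MeasurableSpace Ω] {P : Measure Ω} [IsFiniteMeasure P]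
    {p : ℕ → Ω → Prop} (hp : ∀ n, MeasurableSet {ω | p n ω}) {c : ℝ≥0∞}
    (h : ∀ᶠ n in atTop, c ≤ P {ω | p n ω}) : c ≤ P {ω | ∃ᶠ n in atTop, p n ω} := by
  have key : {ω | ∃ᶠ n in atTop, p n ω} = ⋂ a, {ω | ∃ b, b ≥ a ∧ p b ω} := by
    ext ω; simp [frequently_atTop]
  have hm : ∀ a, MeasurableSet {ω | ∃ b, b ≥ a ∧ p b ω} := fun a => by
    have : {ω | ∃ b, b ≥ a ∧ p b ω} = ⋃ b, ⋃ (_ : b ≥ a), {ω | p b ω} := by ext ω; simp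
    rw [this]
    exact MeasurableSet.iUnion fun b => MeasurableSet.iUnion fun _ => hp b
  have hanti : Antitone fun a => {ω | ∃ b, b ≥ a ∧ p b ω} := by
    rintro a a' haa ω ⟨b, hb, hω⟩
    exact ⟨b, haa.trans hb, hω⟩
  rw [key]
  refine ge_of_tendsto (tendsto_measure_iInter_atTop (fun a => (hm a).nullMeasurableSet) hanti
    ⟨0, measure_ne_top _ _⟩) ?_
  filter_upwards [h] with n hn
  exact hn.trans (measure_mono fun ω hω => ⟨n, le_rfl, hω⟩)

/-- Dropping finitely many summands does not affect how often partial sums fall below multiples of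
the square root. -/
theorem forall_frequently_sum_Ico_lt_iff (y : ℕ → ℝ) (a : ℝ) (m : ℕ) :
    (∀ j : ℕ, ∃ᶠ n in atTop, ∑ k ∈ Finset.Ico m n, y k < (a + 1 / ((j : ℝ) + 1)) * √(n : ℝ)) ↔
      ∀ j : ℕ, ∃ᶠ n in atTop, ∑ k ∈ Finset.range n, y k < (a + 1 / ((j : ℝ) + 1)) * √(n : ℝ) := by
  have key : ∀ (c : ℝ) (u w : ℕ → ℝ), (∀ᶠ n in atTop, w n = u n + c) →
      (∀ j : ℕ, ∃ᶠ n in atTop, u n < (a + 1 / ((j : ℝ) + 1)) * √(n : ℝ)) →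
      ∀ j : ℕ, ∃ᶠ n in atTop, w n < (a + 1 / ((j : ℝ) + 1)) * √(n : ℝ) := by
    intro c u w huw h j
    -- Passing to a smaller margin frees a positive multiple of `√n`, which eventually absorbs the
    -- constant `c`.
    obtain ⟨i, hi⟩ : ∃ i : ℕ, 1 / ((i : ℝ) + 1) < 1 / ((j : ℝ) + 1) :=
      ⟨j + 1, by push_cast; apply one_div_lt_one_div_of_lt <;> linarith [(j.cast_nonneg : (0:ℝ) ≤ j)]⟩
    have hlim : Tendsto (fun n : ℕ => (1 / ((j : ℝ) + 1) - 1 / ((i : ℝ) + 1)) * √(n : ℝ)) atTop atTop :=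
      (Real.tendsto_sqrt_atTop.comp tendsto_natCast_atTop_atTop).const_mul_atTop (by linarith)
    refine ((h i).and_eventually (huw.and (hlim.eventually_ge_atTop c))).mono ?_
    rintro n ⟨h1, h2, h3⟩
    rw [h2]; nlinarith
  have hsplit : ∀ᶠ n in atTop, ∑ k ∈ Finset.range n, y k =
      ∑ k ∈ Finset.Ico m n, y k + ∑ k ∈ Finset.range m, y k := by
    filter_upwards [eventually_ge_atTop m] with n hn
    rw [add_comm, Finset.sum_range_add_sum_Ico _ hn]
  constructor
  · exact key _ _ _ hsplit
  · refine key (-∑ k ∈ Finset.range m, y k) _ _ ?_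
    filter_upwards [hsplit] with n hn
    rw [hn]; ring

/-- If centered partial sums lie below `a √n` with probability bounded away from zero, then almost
surely they lie below `b √n` infinitely often, for every `b > a`. -/
theorem ae_frequently_sum_lt_mul_sqrt {Ω : Type*} [mΩ : MeasurableSpace Ω] {P : Measure Ω}
    [IsProbabilityMeasure P] {Y : ℕ → Ω → ℝ} (hY : ∀ n, AEMeasurable (Y n) P) (hind : iIndepFun Y P)
    {a b : ℝ} (hab : a < b) {c : ℝ≥0∞} (hc : c ≠ 0)
    (h : ∀ᶠ n : ℕ in atTop, c ≤ P {ω | ∑ k ∈ Finset.range n, Y k ω < a * √(n : ℝ)}) :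
    ∀ᵐ ω ∂P, ∃ᶠ n : ℕ in atTop, ∑ k ∈ Finset.range n, Y k ω < b * √(n : ℝ) := by
  -- The tail σ-algebra argument needs truly measurable variables, so each is replaced by a
  -- measurable version.
  wlog hm : ∀ n, Measurable (Y n) generalizing Y
  · have hall : ∀ᵐ ω ∂P, ∀ n, Y n ω = (hY n).mk (Y n) ω := ae_all_iff.2 fun n => (hY n).ae_eq_mk
    have := this (Y := fun n => (hY n).mk (Y n)) (fun n => (hY n).measurable_mk.aemeasurable)
      (hind.congr fun n => (hY n).ae_eq_mk) ?_ (fun n => (hY n).measurable_mk)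
    · filter_upwards [this, hall] with ω h1 h2
      simpa only [h2] using h1
    · filter_upwards [h] with n hn
      refine hn.trans_eq (measure_congr ?_)
      filter_upwards [hall] with ω h2
      apply propext
      change (_ < _) ↔ (_ < _)
      simp only [h2]
  -- Requiring every margin `1/(j+1)` above `a` makes the event independent of `m`; it is then a
  -- tail event, since `B m` involves only the variables from `m` on.
  set B : ℕ → Set Ω := fun m => {ω | ∀ j : ℕ, ∃ᶠ n in atTop,
    ∑ k ∈ Finset.Ico m n, Y k ω < (a + 1 / ((j : ℝ) + 1)) * √(n : ℝ)} with hBdef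
  have hB : ∀ m, B m = B 0 := fun m => by
    ext ω
    have h1 := forall_frequently_sum_Ico_lt_iff (fun k => Y k ω) a m
    have h2 := forall_frequently_sum_Ico_lt_iff (fun k => Y k ω) a 0
    exact h1.trans h2.symm
  have hmeas : ∀ (m' : MeasurableSpace Ω) (m : ℕ), (∀ i, m ≤ i → Measurable[m'] (Y i)) →
      MeasurableSet[m'] (B m) := by
    intro m' m hi
    have : B m = ⋂ j : ℕ, {ω | ∃ᶠ n in atTop,
        ∑ k ∈ Finset.Ico m n, Y k ω < (a + 1 / ((j : ℝ) + 1)) * √(n : ℝ)} := by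
      ext ω; simp [hBdef]
    rw [this]
    refine MeasurableSet.iInter fun j => measurableSet_frequently fun n => ?_
    refine measurableSet_lt (Finset.measurable_fun_sum _ fun i hi' => hi i ?_) measurable_const
    exact (Finset.mem_Ico.1 hi').1
  have htail : MeasurableSet[limsup (fun n => MeasurableSpace.comap (Y n) inferInstance) atTop]
      (B 0) := by
    rw [limsup_eq_iInf_iSup_of_nat, MeasurableSpace.measurableSet_iInf]
    intro m
    rw [← hB m]
    refine hmeas _ m fun i hi => ?_
    refine Measurable.mono (comap_measurable (Y i)) ?_ le_rfl
    exact le_iSup₂_of_le i hi le_rfl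
  have h01 := measure_zero_or_one_of_measurableSet_limsup_atTop
    (fun n => (hm n).comap_le) hind htail
  have hsub : {ω | ∃ᶠ n : ℕ in atTop, ∑ k ∈ Finset.range n, Y k ω < a * √(n : ℝ)} ⊆ B 0 := by
    intro ω hω
    refine (forall_frequently_sum_Ico_lt_iff (fun k => Y k ω) a 0).2 fun j => hω.mono ?_
    intro n hn
    have : 0 ≤ 1 / ((j : ℝ) + 1) * √(n : ℝ) := by positivity
    linarith
  have hpos : c ≤ P (B 0) := (le_measure_frequently (fun n => measurableSet_lt
    (Finset.measurable_fun_sum _ fun i _ => hm i) measurable_const) h).trans (measure_mono hsub)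
  have hone : P (B 0) = 1 := h01.resolve_left fun h0 => hc (by simpa [h0] using hpos)
  have hae : ∀ᵐ ω ∂P, ω ∈ B 0 := by
    rw [← prob_compl_eq_zero_iff (hmeas mΩ 0 fun i _ => hm i)] at hone
    exact hone
  filter_upwards [hae] with ω hω
  obtain ⟨j, hj⟩ := exists_nat_one_div_lt (sub_pos.2 hab)
  refine ((forall_frequently_sum_Ico_lt_iff (fun k => Y k ω) a 0).1 hω j).mono fun n hn => ?_
  have : 0 ≤ √(n : ℝ) := Real.sqrt_nonneg _
  nlinarith

/-! ### Portmanteau bound, conditional laws, and moments of resampled sums. -/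

theorem TendstoInDistribution.exists_le_measure_preimage_of_isOpen {Ω Ω' : Type*}
    [MeasurableSpace Ω] [MeasurableSpace Ω'] {P : Measure Ω} [IsProbabilityMeasure P]
    {Q : Measure Ω'} [IsProbabilityMeasure Q] {X : ℕ → Ω → ℝ} {Z : Ω' → ℝ}
    (h : TendstoInDistribution X atTop Z (fun _ => P) Q) {G : Set ℝ} (hG : IsOpen G)
    (hpos : Q.map Z G ≠ 0) : ∃ c : ℝ≥0∞, c ≠ 0 ∧ ∀ᶠ n in atTop, c ≤ P (X n ⁻¹' G) := by
  have h1 := ProbabilityMeasure.le_liminf_measure_open_of_tendsto h.tendsto hG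
  obtain ⟨c, hc0, hc⟩ := exists_between (pos_iff_ne_zero.2 hpos)
  refine ⟨c, hc0.ne', ?_⟩
  filter_upwards [eventually_lt_of_lt_liminf (hc.trans_le h1)] with n hn
  simp only [ProbabilityMeasure.coe_mk] at hn
  rw [Measure.map_apply_of_aemeasurable (h.forall_aemeasurable n) hG.measurableSet] at hn
  exact hn.le

/-- The conditional law of `F (X, J)` given an independent `X` is the law of `F (x, J)`. -/
theorem condDistrib_comp_prodMk_of_indepFun {Ω D E : Type*} [MeasurableSpace Ω] [MeasurableSpace D]
    [MeasurableSpace E] {P : Measure Ω} [IsProbabilityMeasure P] {X : Ω → D} {J : Ω → E}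
    (hX : AEMeasurable X P) (hJ : AEMeasurable J P) (hind : IndepFun X J P) {F : D × E → ℝ}
    (hF : Measurable F) :
    ∀ᵐ ω ∂P, condDistrib (fun ω => F (X ω, J ω)) X P (X ω) =
      (P.map J).map (fun y => F (X ω, y)) := by
  have : IsProbabilityMeasure (P.map J) := Measure.isProbabilityMeasure_map hJ
  have : IsProbabilityMeasure (P.map X) := Measure.isProbabilityMeasure_map hX
  -- The candidate kernel pushes `δ_x ⊗ law(J)` through `F`; almost-everywhere uniqueness of the
  -- regular conditional law identifies it.
  set κ : Kernel D ℝ := (Kernel.id ×ₖ Kernel.const D (P.map J)).map F with hκdef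
  have hκ : ∀ x, κ x = (P.map J).map (fun y => F (x, y)) := by
    intro x
    rw [hκdef, Kernel.map_apply _ hF, Kernel.prod_apply, Kernel.id_apply, Kernel.const_apply,
      Measure.dirac_prod, Measure.map_map hF (by fun_prop)]
    rfl
  have : IsMarkovKernel κ := Kernel.IsMarkovKernel.map _ hF
  have key : condDistrib (fun ω => F (X ω, J ω)) X P =ᵐ[P.map X] κ := by
    refine condDistrib_ae_eq_of_measure_eq_compProd X
      (hF.comp_aemeasurable (hX.prodMk hJ)) ?_
    have h1 : P.map (fun ω => (X ω, F (X ω, J ω))) =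
        ((P.map X).prod (P.map J)).map (fun p => (p.1, F p)) := by
      rw [← (indepFun_iff_map_prod_eq_prod_map_map hX hJ).1 hind,
        AEMeasurable.map_map_of_aemeasurable (by fun_prop) (hX.prodMk hJ)]
      rfl
    refine Eq.trans h1 ?_
    ext s hs
    rw [Measure.map_apply (by fun_prop) hs, Measure.prod_apply (hs.preimage (by fun_prop)),
      Measure.compProd_apply hs]
    refine lintegral_congr fun x => ?_
    rw [hκ, Measure.map_apply (by fun_prop) (hs.preimage (by fun_prop))]
    rfl
  filter_upwards [ae_of_ae_map hX key] with ω hω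
  rw [hω, hκ]

theorem integral_comp_of_hasLaw_uniformOn_univ {Ω : Type*} [MeasurableSpace Ω] {P : Measure Ω}
    {t : ℕ} (ht : 0 < t) {J : Ω → Fin t} (hJ : HasLaw J (uniformOn Set.univ) P) (a : Fin t → ℝ) :
    ∫ ω, a (J ω) ∂P = (∑ i, a i) / t := by
  have : Nonempty (Fin t) := ⟨⟨0, ht⟩⟩
  have := isProbabilityMeasure_uniformOn (Ω := Fin t) Set.finite_univ Set.univ_nonempty
  have h := hJ.integral_comp (f := a) (by fun_prop)
  simp only [Function.comp_def] at h
  rw [h, integral_fintype Integrable.of_finite, Finset.sum_div]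
  refine Finset.sum_congr rfl fun i _ => ?_
  rw [measureReal_def, uniformOn_univ]
  simp
  ring

/-- Sums of `t` independent uniform draws from `t` numbers of size at most `C` deviate from the sum
of the numbers by at most `√t C` in mean square. -/
theorem integral_sq_sum_resample_sub_le {Ω : Type*} [MeasurableSpace Ω] {P : Measure Ω}
    [IsProbabilityMeasure P] {t : ℕ} (ht : 0 < t) {J : Fin t → Ω → Fin t}
    (hJ : ∀ k, HasLaw (J k) (uniformOn Set.univ) P) (hind : iIndepFun J P) {a : Fin t → ℝ} {C : ℝ}
    (ha : ∀ i, |a i| ≤ C) :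
    ∫ ω, (∑ k, a (J k ω) - ∑ i, a i) ^ 2 ∂P ≤ t * C ^ 2 := by
  have hm : ∀ k, AEMeasurable (fun ω => a (J k ω)) P := fun k =>
    (measurable_of_finite a).comp_aemeasurable (hJ k).aemeasurable
  have hL : ∀ k, MemLp (fun ω => a (J k ω)) 2 P := fun k =>
    MemLp.of_bound (hm k).aestronglyMeasurable C (ae_of_all _ fun ω => ha _)
  have hE : P[∑ k, fun ω => a (J k ω)] = ∑ i, a i := by
    simp only [Finset.sum_apply]
    rw [integral_finsetSum _ fun k _ => (hL k).integrable (by norm_num)]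
    simp only [integral_comp_of_hasLaw_uniformOn_univ ht (hJ _)]
    simp
    field_simp
  have hV := IndepFun.variance_sum (μ := P) (X := fun k ω => a (J k ω)) (s := Finset.univ)
    (fun k _ => hL k) (fun i _ j _ hij =>
      (hind.indepFun hij).comp (measurable_of_finite a) (measurable_of_finite a))
  rw [variance_eq_integral (Finset.aemeasurable_sum _ fun k _ => hm k), hE] at hV
  simp only [Finset.sum_apply] at hV
  rw [hV]
  calc _ ≤ ∑ _k : Fin t, C ^ 2 := Finset.sum_le_sum fun k _ => ?_
    _ = _ := by simp
  refine (variance_le_expectation_sq (hm k).aestronglyMeasurable).trans ?_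
  refine (integral_mono_of_nonneg (ae_of_all _ fun ω => sq_nonneg _) (integrable_const (C ^ 2))
    (ae_of_all _ fun ω => ?_)).trans_eq (by simp)
  exact sq_le_sq' (abs_le.1 (ha _)).1 (abs_le.1 (ha _)).2

/-! ### Lower bounds for the bounded-Lipschitz distance. -/

/-- Without boundedness the real supremum in `blDist` would take a default value and bound nothing.
-/
theorem bddAbove_range_abs_integral_BLOne {E : Type*} [PseudoMetricSpace E] [MeasurableSpace E]
    (ρ L : Measure E) [IsProbabilityMeasure ρ] [IsProbabilityMeasure L] :
    BddAbove (Set.range fun f : BLOne E => |(∫ x, f.1 x ∂ρ) - ∫ x, f.1 x ∂L|) := by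
  refine ⟨2, ?_⟩
  rintro _ ⟨f, rfl⟩
  have h : ∀ (μ : Measure E) [IsProbabilityMeasure μ], |∫ x, f.1 x ∂μ| ≤ 1 := fun μ _ => by
    simpa using norm_integral_le_of_norm_le_const (μ := μ) (f := f.1) (C := 1)
      (ae_of_all _ fun x => by simpa using f.2.1 x)
  have := abs_sub (∫ x, f.1 x ∂ρ) (∫ x, f.1 x ∂L)
  simp only
  linarith [h ρ, h L]

theorem abs_integral_sub_le_blDist {E : Type*} [PseudoMetricSpace E] [MeasurableSpace E]
    (ρ L : Measure E) [IsProbabilityMeasure ρ] [IsProbabilityMeasure L] {f : E → ℝ}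
    (hf : f ∈ BLOne E) : |(∫ x, f x ∂ρ) - ∫ x, f x ∂L| ≤ blDist ρ L :=
  le_ciSup (bddAbove_range_abs_integral_BLOne ρ L) ⟨f, hf⟩

/-! ### Closed form of the single-buyer multiplier. -/

namespace AuctionMarket

variable {Θ : Type*} [MeasurableSpace Θ]

/-- The total value of the items `γ` to a single buyer. -/
noncomputable def totalValue (M : AuctionMarket (Fin 1) Θ) {t : ℕ} (γ : Fin t → Θ) : ℝ :=
  ∑ τ, M.value 0 (γ τ)

/-- The pacing multiplier of a single buyer with unit budget and mean value `m`. -/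
noncomputable def multiplierOfMean (m : ℝ) : ℝ := (max m 1)⁻¹

theorem multiplierOfMean_of_le_one {m : ℝ} (hm : m ≤ 1) : multiplierOfMean m = 1 := by
  simp [multiplierOfMean, max_eq_right hm]

theorem multiplierOfMean_of_one_le {m : ℝ} (hm : 1 ≤ m) : multiplierOfMean m = m⁻¹ := by
  simp [multiplierOfMean, max_eq_left hm]

theorem multiplierOfMean_pos (m : ℝ) : 0 < multiplierOfMean m :=
  inv_pos.2 (lt_of_lt_of_le one_pos (le_max_right _ _))

theorem multiplierOfMean_le_one (m : ℝ) : multiplierOfMean m ≤ 1 :=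
  inv_le_one_of_one_le₀ (le_max_right _ _)

theorem continuous_multiplierOfMean : Continuous multiplierOfMean :=
  (continuous_id.max continuous_const).inv₀ fun _ =>
    (lt_of_lt_of_le one_pos (le_max_right _ _)).ne'

/-- Full allocation makes the payment `β m`. The budget gives `β m ≤ 1`, and a strict inequality
forces `β = 1`. -/
theorem IsFiniteFPPE.multiplier_eq {M : AuctionMarket (Fin 1) Θ} (hbudget : M.budget 0 = 1) {t : ℕ}
    {γ : Fin t → Θ} {β : Fin 1 → ℝ} {p : Fin t → ℝ}
    (h : M.IsFiniteFPPE (1 / (t : ℝ)) γ β p) :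
    β 0 = multiplierOfMean (M.totalValue γ / t) := by
  obtain ⟨hβ, hp0, x, hx, hp, -, hle, -, hfull, hpace⟩ := h
  simp only [ciSup_unique, Fin.default_eq_zero] at hp
  have hxp : ∀ τ, x 0 τ * p τ = β 0 * M.value 0 (γ τ) := fun τ => by
    rw [← hp]
    rcases (hp0 τ).eq_or_lt with h0 | h0
    · simp [← h0]
    · have := hfull τ h0
      simp only [Fin.sum_univ_one] at this
      simp [this]
  have hpay : 1 / (t : ℝ) * ∑ τ, x 0 τ * p τ = β 0 * (M.totalValue γ / t) := by
    simp only [hxp, totalValue, ← Finset.mul_sum]; ring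
  have h1 := hle 0
  have h2 := hpace 0
  rw [hpay, hbudget] at h1 h2
  set m := M.totalValue γ / t
  have hb0 := (hβ 0).1
  have hb1 := (hβ 0).2
  rcases le_total m 1 with hm | hm
  · rw [multiplierOfMean_of_le_one hm]
    by_contra hne
    have hlt : β 0 < 1 := lt_of_le_of_ne hb1 hne
    exact hne (h2 (by nlinarith))
  · rw [multiplierOfMean_of_one_le hm]
    refine eq_inv_of_mul_eq_one_left ?_
    by_contra hne
    have hlt : β 0 * m < 1 := lt_of_le_of_ne h1 hne
    rw [h2 hlt] at hlt
    linarith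

/-- The objective is `β m - log β`. The strict inequality `log u < u - 1` for `u ≠ 1`, taken at `u =
β` or `u = β m`, rules out any other minimizer. -/
theorem IsEGMinimizer.multiplier_eq {M : AuctionMarket (Fin 1) Θ} (hbudget : M.budget 0 = 1) {t : ℕ}
    (ht : 0 < t) {γ : Fin t → Θ} {β : Fin 1 → ℝ} (h : M.IsEGMinimizer γ β) :
    β 0 = multiplierOfMean (M.totalValue γ / t) := by
  obtain ⟨hβ, hmin⟩ := h
  set m := M.totalValue γ / t with hm
  have hEG : ∀ b : Fin 1 → ℝ, M.sampleEG γ b = b 0 * m - Real.log (b 0) := fun b => by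
    have : (t : ℝ) ≠ 0 := by positivity
    simp only [sampleEG, ciSup_unique, Fin.default_eq_zero, Fin.sum_univ_one, hbudget, one_mul,
      Finset.sum_sub_distrib, ← Finset.mul_sum, hm, totalValue]
    simp
    field_simp
  have h1 := hmin (a := fun _ => multiplierOfMean m)
    (fun _ => ⟨multiplierOfMean_pos m, multiplierOfMean_le_one m⟩)
  simp only [Set.mem_ofPred_eq, hEG] at h1
  have hb0 := (hβ 0).1
  have hb1 := (hβ 0).2
  rcases le_total m 1 with hm1 | hm1
  · rw [multiplierOfMean_of_le_one hm1] at h1 ⊢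
    by_contra hne
    have := Real.log_lt_sub_one_of_pos hb0 hne
    rw [Real.log_one] at h1
    nlinarith
  · rw [multiplierOfMean_of_one_le hm1] at h1 ⊢
    have hm0 : 0 < m := by linarith
    by_contra hne
    have := Real.log_lt_sub_one_of_pos (mul_pos hb0 hm0)
      (fun h => hne (eq_inv_of_mul_eq_one_left h))
    rw [Real.log_mul hb0.ne' hm0.ne'] at this
    rw [Real.log_inv, inv_mul_cancel₀ hm0.ne'] at h1
    linarith

theorem expect_eq_integral_itemLaw {ι : Type*} (M : AuctionMarket ι Θ) (g : Θ → ℝ) :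
    M.expect g = ∫ θ, g θ ∂M.itemLaw := by
  rw [itemLaw, integral_withDensity_eq_integral_toReal_smul
    M.supply_measurable.ennreal_ofReal (by simp)]
  simp only [expect, smul_eq_mul, ENNReal.toReal_ofReal (M.supply_nonneg _), mul_comm]

/-- Since the mean value is 1, the payment equals `β`; were `β < 1`, money would be left over, which
forces `β = 1`. -/
theorem IsLimitFPPEWith.isDegenerate {M : AuctionMarket (Fin 1) Θ} (hbudget : M.budget 0 = 1)
    (hmean : M.expect (M.value 0) = 1) {β : Fin 1 → ℝ} {p : Θ → ℝ} {x : Fin 1 → Θ → ℝ}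
    (h : M.IsLimitFPPEWith β p x) : M.IsDegenerate β p x 0 := by
  have hp := h.first_price
  simp only [ciSup_unique, Fin.default_eq_zero] at hp
  have hxp : ∀ θ, x 0 θ * p θ = β 0 * M.value 0 θ := fun θ => by
    have h0 : 0 ≤ p θ := by
      rw [hp]; exact mul_nonneg (h.multiplier_mem 0).1 (M.value_nonneg 0 θ)
    rw [← hp]
    rcases h0.eq_or_lt with h0 | h0
    · simp [← h0]
    · have := h.fully_allocated θ h0
      simp only [Fin.sum_univ_one] at this
      simp [this]
  have hpay : M.pay p (x 0) = β 0 := by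
    simp only [pay, hxp, mul_assoc, integral_const_mul]
    change β 0 * M.expect (M.value 0) = β 0
    rw [hmean, mul_one]
  have hβ : β 0 = 1 := by
    by_contra hne
    refine hne (h.no_unnecessary_pacing 0 ?_)
    rw [hpay, hbudget]
    exact lt_of_le_of_ne (h.multiplier_mem 0).2 hne
  exact ⟨hβ, by rw [hpay, hbudget, hβ, sub_self]⟩

/-- The scaled bootstrap deviation of the multiplier, as a function of data and drawn indices. -/
noncomputable def bootstrapDeviation (M : AuctionMarket (Fin 1) Θ) (t : ℕ)
    (q : (Fin t → Θ) × (Fin t → Fin t)) : ℝ :=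
  √(t : ℝ) * (multiplierOfMean (M.totalValue (fun k => q.1 (q.2 k)) / t) -
    multiplierOfMean (M.totalValue q.1 / t))

theorem measurable_bootstrapDeviation (M : AuctionMarket (Fin 1) Θ) (t : ℕ) :
    Measurable (M.bootstrapDeviation t) := by
  have hv := M.value_measurable 0
  have h1 : ∀ k, Measurable fun q : (Fin t → Θ) × (Fin t → Fin t) => M.value 0 (q.1 (q.2 k)) :=
    fun k => measurable_from_prod_countable_left fun y => hv.comp (measurable_pi_apply (y k))
  have h2 : ∀ k, Measurable fun q : (Fin t → Θ) × (Fin t → Fin t) => M.value 0 (q.1 k) :=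
    fun k => hv.comp ((measurable_pi_apply k).comp measurable_fst)
  have hG := continuous_multiplierOfMean.measurable
  unfold bootstrapDeviation totalValue
  exact ((hG.comp ((Finset.measurable_fun_sum _ fun k _ => h1 k).div_const _)).sub
    (hG.comp ((Finset.measurable_fun_sum _ fun k _ => h2 k).div_const _))).const_mul _

end AuctionMarket

/-! ### A bounded Lipschitz test function that detects negative mass. -/

/-- The truncation of a real number to `[-1, 0]`. -/
noncomputable def truncateNeg (x : ℝ) : ℝ := max (-1) (min x 0)

theorem truncateNeg_nonpos (x : ℝ) : truncateNeg x ≤ 0 :=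
  max_le (by norm_num) (min_le_right _ _)

theorem neg_one_le_truncateNeg (x : ℝ) : -1 ≤ truncateNeg x := le_max_left _ _

theorem truncateNeg_mem_BLOne : truncateNeg ∈ BLOne ℝ := by
  refine ⟨fun x => abs_le.2 ⟨neg_one_le_truncateNeg x, (truncateNeg_nonpos x).trans zero_le_one⟩,
    fun x y => ?_⟩
  refine (abs_max_sub_max_le_max _ _ _ _).trans ?_
  refine max_le (by simp) ((abs_min_sub_min_le_max _ _ _ _).trans ?_)
  exact max_le (le_of_eq (Real.dist_eq x y).symm) (by simp)

theorem continuous_truncateNeg : Continuous truncateNeg :=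
  continuous_const.max (continuous_id.min continuous_const)

theorem integrable_truncateNeg_comp {α : Type*} [MeasurableSpace α] {μ : Measure α}
    [IsFiniteMeasure μ] {g : α → ℝ} (hg : AEMeasurable g μ) :
    Integrable (fun x => truncateNeg (g x)) μ :=
  Integrable.of_bound (continuous_truncateNeg.measurable.comp_aemeasurable hg).aestronglyMeasurable
    1 (ae_of_all _ fun x => by simpa using truncateNeg_mem_BLOne.1 (g x))

theorem gaussianReal_Iio_ne_zero {v : NNReal} (hv : v ≠ 0) (a : ℝ) :
    gaussianReal 0 v (Set.Iio a) ≠ 0 := fun h => by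
  simpa using gaussianReal_absolutelyContinuous' 0 hv h

theorem integral_truncateNeg_map_min_gaussianReal_neg {v : NNReal} (hv : v ≠ 0) :
    ∫ x, truncateNeg x ∂((gaussianReal 0 v).map fun z => min z 0) < 0 := by
  rw [integral_map (by fun_prop) continuous_truncateNeg.aestronglyMeasurable]
  have hint := integrable_truncateNeg_comp (μ := gaussianReal 0 v) (g := fun z => min z 0)
    (by fun_prop)
  rw [← neg_pos, ← integral_neg, integral_pos_iff_support_of_nonneg
    (fun z => neg_nonneg.2 (truncateNeg_nonpos _)) hint.neg]
  refine (pos_iff_ne_zero.2 (gaussianReal_Iio_ne_zero hv 0)).trans_le (measure_mono fun z hz => ?_)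
  have hz' : z < 0 := hz
  have : truncateNeg (min z 0) < 0 := by
    simp only [truncateNeg]
    exact max_lt (by norm_num) (min_lt_of_left_lt (min_lt_of_left_lt hz'))
  simpa using this.ne

/-! ### The gap between the bootstrap law and the half-normal limit. -/

namespace AuctionMarket

variable {Θ : Type*} [MeasurableSpace Θ]

/-- The data multiplier is 1, so only an overshoot `B > t` matters. Its size is bounded by the
square of the resampling error, so that a second moment suffices afterwards. -/
theorem neg_sq_div_le_truncateNeg_bootstrapDeviation (M : AuctionMarket (Fin 1) Θ) {t : ℕ}
    (ht : 0 < t) {K : ℝ} (hK : 0 < K) {x : Fin t → Θ} (hx : M.totalValue x - t ≤ -K * √(t : ℝ))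
    (y : Fin t → Fin t) :
    -((M.totalValue (fun k => x (y k)) - M.totalValue x) ^ 2 / (4 * K * t)) ≤
      truncateNeg (M.bootstrapDeviation t (x, y)) := by
  have ht' : (0 : ℝ) < t := by exact_mod_cast ht
  have hr : 0 < √(t : ℝ) := Real.sqrt_pos.2 ht'
  have hr2 : √(t : ℝ) * √(t : ℝ) = t := Real.mul_self_sqrt ht'.le
  simp only [bootstrapDeviation]
  set s := M.totalValue x
  set B := M.totalValue (fun k => x (y k))
  set r := √(t : ℝ)
  have hs1 : s / t ≤ 1 := (div_le_one ht').2 (by nlinarith)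
  rw [multiplierOfMean_of_le_one hs1]
  have hz0 : r * (multiplierOfMean (B / t) - 1) ≤ 0 :=
    mul_nonpos_of_nonneg_of_nonpos hr.le (by linarith [multiplierOfMean_le_one (B / t)])
  refine le_trans ?_ (le_max_right _ _)
  rw [min_eq_left hz0]
  rcases le_total (B / t) 1 with hB | hB
  · rw [multiplierOfMean_of_le_one hB, sub_self, mul_zero]
    have : 0 ≤ (B - s) ^ 2 / (4 * K * t) := by positivity
    linarith
  · rw [multiplierOfMean_of_one_le hB]
    have hB0 : 0 < B / t := by linarith
    have h1 : 1 - (B / t)⁻¹ ≤ B / t - 1 := by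
      have h3 : B / t * (B / t)⁻¹ = 1 := mul_inv_cancel₀ hB0.ne'
      have h4 : 0 < (B / t)⁻¹ := inv_pos.2 hB0
      nlinarith [mul_nonneg h4.le (sq_nonneg (B / t - 1))]
    have h2 : r * (B / t - 1) ≤ (B - s) ^ 2 / (4 * K * t) := by
      have e1 : r * (B / t - 1) = (B - t) / r := by
        rw [← hr2]; field_simp
      rw [e1, ← hr2, div_le_div_iff₀ hr (by positivity)]
      have h5 : B - t ≤ B - s - K * r := by linarith
      -- With `D = B - s` this is `(D - 2Kr)² ≥ 0`, the origin of the factor 4.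
      have h6 : (B - s - K * r) * (4 * K * r) ≤ (B - s) ^ 2 := by
        nlinarith [sq_nonneg (B - s - 2 * (K * r))]
      have h7 : (B - t) * (4 * K * r) ≤ (B - s) ^ 2 :=
        (mul_le_mul_of_nonneg_right h5 (by positivity)).trans h6
      have h8 := mul_le_mul_of_nonneg_right h7 hr.le
      rw [← hr2] at h8
      linarith
    linarith [mul_le_mul_of_nonneg_left h1 hr.le]

/-- The resampling variance `t C²` cancels the `t` in the pointwise bound, which leaves an estimate
uniform in `t`. -/
theorem neg_le_integral_truncateNeg_bootstrapDeviation {Ω : Type*} [MeasurableSpace Ω]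
    {P : Measure Ω} [IsProbabilityMeasure P] (M : AuctionMarket (Fin 1) Θ) {C : ℝ}
    (hC : ∀ θ, M.value 0 θ ≤ C) {t : ℕ} (ht : 0 < t) {J : Fin t → Ω → Fin t}
    (hJ : ∀ k, HasLaw (J k) (uniformOn Set.univ) P) (hind : iIndepFun J P) {K : ℝ} (hK : 0 < K)
    {x : Fin t → Θ} (hx : M.totalValue x - t ≤ -K * √(t : ℝ)) :
    -(C ^ 2 / (4 * K)) ≤ ∫ z, truncateNeg z ∂(P.map fun ω k => J k ω).map
      (fun y => M.bootstrapDeviation t (x, y)) := by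
  have ht' : (0 : ℝ) < t := by exact_mod_cast ht
  have hJm : AEMeasurable (fun ω k => J k ω) P := aemeasurable_pi_iff.2 fun k => (hJ k).aemeasurable
  have hF : Measurable fun y => M.bootstrapDeviation t (x, y) := measurable_of_finite _
  rw [integral_map hF.aemeasurable continuous_truncateNeg.aestronglyMeasurable,
    integral_map hJm (measurable_of_finite _).aestronglyMeasurable]
  have hsq := integral_sq_sum_resample_sub_le ht hJ hind (a := fun i => M.value 0 (x i))
    (C := C) (fun i => by rw [abs_of_nonneg (M.value_nonneg 0 _)]; exact hC _)
  have hint : Integrable (fun ω => (∑ k, M.value 0 (x (J k ω)) - ∑ i, M.value 0 (x i)) ^ 2) P := by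
    have : Integrable (fun y : Fin t → Fin t =>
        (∑ k, M.value 0 (x (y k)) - ∑ i, M.value 0 (x i)) ^ 2) (P.map fun ω k => J k ω) :=
      Integrable.of_finite
    exact this.comp_aemeasurable hJm
  calc -(C ^ 2 / (4 * K)) = -(t * C ^ 2 / (4 * K * t)) := by field_simp
    _ ≤ -((∫ ω, (∑ k, M.value 0 (x (J k ω)) - ∑ i, M.value 0 (x i)) ^ 2 ∂P) / (4 * K * t)) := by
      gcongr
    _ = ∫ ω, -((∑ k, M.value 0 (x (J k ω)) - ∑ i, M.value 0 (x i)) ^ 2 / (4 * K * t)) ∂P := by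
      rw [integral_neg, integral_div]
    _ ≤ _ := integral_mono (hint.div_const _).neg
      (integrable_truncateNeg_comp (hF.comp_aemeasurable hJm))
      fun ω => M.neg_sq_div_le_truncateNeg_bootstrapDeviation ht hK hx _

/-- Where the data undershoot their mean by a large multiple of `√t`, the bootstrap law is
bounded away from the half-normal limit. -/
theorem exists_le_condBLDist_bootstrapDeviation {Ω : Type*} [MeasurableSpace Ω]
    {P : Measure Ω} [IsProbabilityMeasure P] (M : AuctionMarket (Fin 1) Θ) {θ : ℕ → Ω → Θ}
    (hθ : ∀ τ, AEMeasurable (θ τ) P) {J : (t : ℕ) → Fin t → Ω → Fin t}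
    (hJ : IsMultinomialResampling P θ J) {v : NNReal} (hv : v ≠ 0) :
    ∃ K > 0, ∃ δ > 0, ∀ᵐ ω ∂P, ∀ t : ℕ, 0 < t →
      M.totalValue (firstItems θ t ω) - t ≤ -K * √(t : ℝ) →
      δ ≤ condBLDist P (firstItems θ t)
        (fun ω' => M.bootstrapDeviation t (firstItems θ t ω', fun k => J t k ω'))
        ((gaussianReal 0 v).map fun z => min z 0) ω := by
  obtain ⟨C, hC⟩ := M.value_bounded
  have hc := integral_truncateNeg_map_min_gaussianReal_neg hv
  set c := ∫ x, truncateNeg x ∂((gaussianReal 0 v).map fun z => min z 0) with hcdef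
  -- This `K` makes `C²/(4K) ≤ -c/2`, half the gap to `c`; the `+ 1` keeps `K` positive when `C =
  -- 0`.
  refine ⟨(C ^ 2 + 1) / (2 * -c), div_pos (by positivity) (by linarith), -c / 2, by linarith, ?_⟩
  rw [ae_all_iff]
  intro t
  rcases Nat.eq_zero_or_pos t with rfl | ht
  · simp
  have hX : AEMeasurable (firstItems θ t) P := aemeasurable_pi_iff.2 fun τ => hθ τ
  have hJm : AEMeasurable (fun ω k => J t k ω) P :=
    aemeasurable_pi_iff.2 fun k => (hJ.uniform t k).aemeasurable
  filter_upwards [condDistrib_comp_prodMk_of_indepFun hX hJm (hJ.indep_data t)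
    (M.measurable_bootstrapDeviation t)] with ω hω _ hx
  have h1 := M.neg_le_integral_truncateNeg_bootstrapDeviation (hC 0) ht (hJ.uniform t)
    (hJ.indep_draws t) (div_pos (by positivity) (by linarith)) hx
  have : IsProbabilityMeasure ((gaussianReal 0 v).map fun z => min z 0) :=
    Measure.isProbabilityMeasure_map (by fun_prop)
  have h2 := abs_integral_sub_le_blDist (condDistrib (fun ω' => M.bootstrapDeviation t
    (firstItems θ t ω', fun k => J t k ω')) (firstItems θ t) P (firstItems θ t ω))
    ((gaussianReal 0 v).map fun z => min z 0) truncateNeg_mem_BLOne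
  rw [hω, ← hcdef] at h2
  rw [condBLDist, hω]
  refine le_trans ?_ ((le_abs_self _).trans h2)
  have h3 : C ^ 2 / (4 * ((C ^ 2 + 1) / (2 * -c))) ≤ -c / 2 := by
    have hc' : 0 < -c := by linarith
    generalize -c = d at hc'
    rw [div_le_iff₀ (by positivity)]
    field_simp
    linarith
  linarith

end AuctionMarket

/-! ### Limit theorems for the sample total and the finite multiplier. -/

namespace AuctionMarket

theorem totalValue_firstItems {Ω Θ : Type*} [MeasurableSpace Θ] (M : AuctionMarket (Fin 1) Θ)
    (θ : ℕ → Ω → Θ) (t : ℕ) (ω : Ω) :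
    M.totalValue (firstItems θ t ω) = ∑ k ∈ Finset.range t, M.value 0 (θ k ω) := by
  simp only [totalValue, firstItems]
  exact Fin.sum_univ_eq_sum_range (fun k => M.value 0 (θ k ω)) t

variable {Ω Θ : Type*} [MeasurableSpace Ω] [MeasurableSpace Θ] {P : Measure Ω}
  {M : AuctionMarket (Fin 1) Θ} {θ : ℕ → Ω → Θ}

theorem identDistrib_value (hθ_law : ∀ τ, HasLaw (θ τ) M.itemLaw P) (n : ℕ) :
    IdentDistrib (fun ω => M.value 0 (θ n ω)) (fun ω => M.value 0 (θ 0 ω)) P P :=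
  IdentDistrib.comp ⟨(hθ_law n).aemeasurable, (hθ_law 0).aemeasurable,
    (hθ_law n).map_eq.trans (hθ_law 0).map_eq.symm⟩ (M.value_measurable 0)

theorem iIndepFun_value (hθ_indep : iIndepFun θ P) :
    iIndepFun (fun n ω => M.value 0 (θ n ω)) P :=
  hθ_indep.comp (fun _ => M.value 0) fun _ => M.value_measurable 0

theorem aemeasurable_value (hθ_law : ∀ τ, HasLaw (θ τ) M.itemLaw P) (n : ℕ) :
    AEMeasurable (fun ω => M.value 0 (θ n ω)) P :=
  (M.value_measurable 0).comp_aemeasurable (hθ_law n).aemeasurable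

theorem integral_value_comp (hθ_law : ∀ τ, HasLaw (θ τ) M.itemLaw P) (n : ℕ) {f : ℝ → ℝ}
    (hf : Measurable f) :
    ∫ ω, f (M.value 0 (θ n ω)) ∂P = M.expect fun x => f (M.value 0 x) := by
  rw [expect_eq_integral_itemLaw]
  exact (hθ_law n).integral_comp
    (hf.comp (M.value_measurable 0)).aestronglyMeasurable

variable [IsProbabilityMeasure P]

theorem memLp_two_value (hθ_law : ∀ τ, HasLaw (θ τ) M.itemLaw P) (n : ℕ) :
    MemLp (fun ω => M.value 0 (θ n ω)) 2 P := by
  obtain ⟨C, hC⟩ := M.value_bounded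
  refine MemLp.of_bound (aemeasurable_value hθ_law n).aestronglyMeasurable C (ae_of_all _ fun ω => ?_)
  rw [Real.norm_of_nonneg (M.value_nonneg 0 _)]
  exact hC 0 _

theorem variance_value (hθ_law : ∀ τ, HasLaw (θ τ) M.itemLaw P) :
    Var[fun ω => M.value 0 (θ 0 ω); P] = M.variance (M.value 0) := by
  rw [variance_eq_sub (memLp_two_value hθ_law 0)]
  have h1 := integral_value_comp hθ_law 0 measurable_id
  have h2 := integral_value_comp hθ_law 0 (f := fun x => x ^ 2) (by fun_prop)
  simp only [id] at h1
  simp only [Pi.pow_apply, h1, h2, variance]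

/-- The total value of the observed items obeys the central limit theorem. -/
theorem tendstoInDistribution_totalValue (hmean : M.expect (M.value 0) = 1)
    (hθ_law : ∀ τ, HasLaw (θ τ) M.itemLaw P) (hθ_indep : iIndepFun θ P) :
    TendstoInDistribution
      (fun (t : ℕ) ω => (√(t : ℝ))⁻¹ * (M.totalValue (firstItems θ t ω) - t)) atTop
      (fun z : ℝ => -z) (fun _ => P) (gaussianReal 0 (M.variance (M.value 0)).toNNReal) := by
  have h1 := integral_value_comp hθ_law 0 measurable_id
  simp only [id] at h1
  -- The limit is realized as `-z`, with the same Gaussian law, so that `-max (-z) 0` later becomes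
  -- literally `min z 0`.
  have hlaw : HasLaw (fun z : ℝ => -z)
      (gaussianReal 0 Var[fun ω => M.value 0 (θ 0 ω); P].toNNReal)
      (gaussianReal 0 (M.variance (M.value 0)).toNNReal) := by
    rw [variance_value hθ_law]
    exact ⟨by fun_prop, by rw [gaussianReal_map_neg, neg_zero]⟩
  have := tendstoInDistribution_inv_sqrt_mul_sum_sub (P := P)
    (P' := gaussianReal 0 (M.variance (M.value 0)).toNNReal)
    (X := fun n ω => M.value 0 (θ n ω)) (Y := fun z => -z) hlaw (memLp_two_value hθ_law 0)
    (iIndepFun_value hθ_indep) (identDistrib_value hθ_law)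
  simpa only [h1, hmean, mul_one, totalValue_firstItems] using this

/-- An exact factorization prepared for Slutsky: the first factor is continuous in the normalized
sum, the second tends to 1. It replaces a delta method, which the kink does not permit. -/
theorem sqrt_mul_multiplierOfMean_sub_one (t : ℕ) (s : ℝ) :
    √(t : ℝ) * (multiplierOfMean (s / t) - 1) =
      -max ((√(t : ℝ))⁻¹ * (s - t)) 0 * multiplierOfMean (s / t) := by
  rcases Nat.eq_zero_or_pos t with rfl | ht
  · simp
  have ht' : (0 : ℝ) < t := by exact_mod_cast ht
  have hr : 0 < √(t : ℝ) := Real.sqrt_pos.2 ht'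
  rcases le_total (s / t) 1 with h | h
  · have hs : s - t ≤ 0 := by rw [div_le_one ht'] at h; linarith
    rw [multiplierOfMean_of_le_one h,
      max_eq_right (mul_nonpos_of_nonneg_of_nonpos (inv_nonneg.2 hr.le) hs)]
    simp
  · have hs : t ≤ s := by rwa [one_le_div ht'] at h
    have hs0 : 0 < s := by linarith
    rw [multiplierOfMean_of_one_le h,
      max_eq_left (mul_nonneg (inv_nonneg.2 hr.le) (by linarith))]
    field_simp
    rw [Real.sq_sqrt ht'.le]
    ring

theorem tendstoInDistribution_multiplierOfMean (hmean : M.expect (M.value 0) = 1)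
    (hθ_law : ∀ τ, HasLaw (θ τ) M.itemLaw P) (hθ_indep : iIndepFun θ P) :
    TendstoInDistribution
      (fun (t : ℕ) ω =>
        √(t : ℝ) * (multiplierOfMean (M.totalValue (firstItems θ t ω) / t) - 1)) atTop
      (fun z : ℝ => min z 0) (fun _ => P) (gaussianReal 0 (M.variance (M.value 0)).toNNReal) := by
  have hm : ∀ t : ℕ, AEMeasurable
      (fun ω => multiplierOfMean (M.totalValue (firstItems θ t ω) / t)) P := fun t => by
    simp only [totalValue_firstItems]
    exact continuous_multiplierOfMean.measurable.comp_aemeasurable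
      ((Finset.aemeasurable_fun_sum _ fun k _ => aemeasurable_value hθ_law k).div_const _)
  -- The strong law sends the sample mean to 1, where the multiplier is continuous with value 1.
  have hY : TendstoInMeasure P
      (fun (t : ℕ) ω => multiplierOfMean (M.totalValue (firstItems θ t ω) / t)) atTop
      (fun _ => (1 : ℝ)) := by
    refine tendstoInMeasure_of_tendsto_ae (fun t => (hm t).aestronglyMeasurable) ?_
    have h1 := integral_value_comp hθ_law 0 measurable_id
    simp only [id] at h1
    filter_upwards [strong_law_ae_real (fun n ω => M.value 0 (θ n ω))
      ((memLp_two_value hθ_law 0).integrable (by norm_num))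
      (fun i j hij => (iIndepFun_value hθ_indep).indepFun hij)
      (identDistrib_value hθ_law)] with ω hω
    rw [h1, hmean] at hω
    have := (continuous_multiplierOfMean.tendsto 1).comp hω
    rw [multiplierOfMean_of_le_one le_rfl] at this
    simpa only [totalValue_firstItems, Function.comp_def] using this
  have := (tendstoInDistribution_totalValue hmean hθ_law
    hθ_indep).continuous_comp_prodMk_of_tendstoInMeasure_const
    (g := fun q : ℝ × ℝ => -max q.1 0 * q.2) (by fun_prop) hY hm
  simp only [sqrt_mul_multiplierOfMean_sub_one]
  convert! this using 2 with z
  rw [mul_one, ← min_neg_neg, neg_neg, neg_zero]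

end AuctionMarket

/-! ### Assembly of the three claims. -/

theorem mainTheorem5 {Ω Θ : Type*} [MeasurableSpace Ω] [MeasurableSpace Θ]
    (P : Measure Ω) [IsProbabilityMeasure P]
    (M : AuctionMarket (Fin 1) Θ)
    (hbudget : M.budget 0 = 1)
    (hmean : M.expect (M.value 0) = 1)
    (hvar : 0 < M.variance (M.value 0))
    -- the limit equilibrium
    (βstar : Fin 1 → ℝ) (pstar : Θ → ℝ) (xstar : Fin 1 → Θ → ℝ)
    (hstar : M.IsLimitFPPEWith βstar pstar xstar)
    -- the observed items and the finite equilibria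
    (θ : ℕ → Ω → Θ) (hθ_law : ∀ τ, HasLaw (θ τ) M.itemLaw P) (hθ_indep : iIndepFun θ P)
    (βγ : ℕ → Ω → Fin 1 → ℝ)
    (hβγ : ∀ t : ℕ, 0 < t → ∀ ω, ∃ p, M.IsFiniteFPPE (1 / (t : ℝ)) (firstItems θ t ω) (βγ t ω) p)
    -- the multinomial bootstrap
    (J : (t : ℕ) → Fin t → Ω → Fin t) (hJ : IsMultinomialResampling P θ J)
    (βb : ℕ → Ω → Fin 1 → ℝ)
    (hβb : ∀ t : ℕ, 0 < t → ∀ ω, M.IsEGMinimizer (resampledItems θ J t ω) (βb t ω)) :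
    -- the buyer is degenerate
    M.IsDegenerate βstar pstar xstar 0 ∧
    -- the limit law of the finite equilibrium
    TendstoInDistribution (fun (t : ℕ) ω => √(t : ℝ) * (βγ t ω 0 - βstar 0)) atTop
      (fun z : ℝ => min z 0) (fun _ => P)
      (gaussianReal 0 (M.variance (M.value 0)).toNNReal) ∧
    (∀ t : ℕ, AEMeasurable (fun ω => √(t : ℝ) * (βb t ω 0 - βγ t ω 0)) P) ∧
    -- the bootstrap does not consistently estimate that law
    ¬ ConditionallyConsistent P (firstItems θ)
        (fun (t : ℕ) ω => √(t : ℝ) * (βb t ω 0 - βγ t ω 0))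
        ((gaussianReal 0 (M.variance (M.value 0)).toNNReal).map (fun z => min z 0)) ∧
    -- nor do the conditional laws converge to it along almost any realization of the data
    ∀ᵐ ω ∂P, ¬ Tendsto (fun t : ℕ => condBLDist P (firstItems θ t)
        (fun ω' => √(t : ℝ) * (βb t ω' 0 - βγ t ω' 0))
        ((gaussianReal 0 (M.variance (M.value 0)).toNNReal).map (fun z => min z 0)) ω)
      atTop (𝓝 0) := by
  have hdeg := hstar.isDegenerate hbudget hmean
  have hγ : ∀ (t : ℕ) ω, √(t : ℝ) * (βγ t ω 0 - βstar 0) =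
      √(t : ℝ) * (AuctionMarket.multiplierOfMean (M.totalValue (firstItems θ t ω) / t) - 1) := by
    intro t ω
    rcases Nat.eq_zero_or_pos t with rfl | ht
    · simp
    obtain ⟨p, hp⟩ := hβγ t ht ω
    rw [hp.multiplier_eq hbudget, hdeg.1]
  have hb : ∀ t : ℕ, (fun ω => √(t : ℝ) * (βb t ω 0 - βγ t ω 0)) =
      fun ω => M.bootstrapDeviation t (firstItems θ t ω, fun k => J t k ω) := by
    intro t
    funext ω
    rcases Nat.eq_zero_or_pos t with rfl | ht
    · simp [AuctionMarket.bootstrapDeviation]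
    obtain ⟨p, hp⟩ := hβγ t ht ω
    rw [hp.multiplier_eq hbudget, (hβb t ht ω).multiplier_eq hbudget ht]
    rfl
  have hclt := AuctionMarket.tendstoInDistribution_totalValue hmean hθ_law hθ_indep
  have hv : (M.variance (M.value 0)).toNNReal ≠ 0 := (Real.toNNReal_pos.2 hvar).ne'
  obtain ⟨K, hK, δ, hδ, hfar⟩ := M.exists_le_condBLDist_bootstrapDeviation
    (fun τ => (hθ_law τ).aemeasurable) hJ hv
  -- The threshold is `-(K + 1)` rather than `-K` because the 0-1 law gives up some room between its
  -- two levels.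
  obtain ⟨c, hc, hprob⟩ := TendstoInDistribution.exists_le_measure_preimage_of_isOpen hclt
    (isOpen_Iio (a := -(K + 1))) (by
      rw [gaussianReal_map_neg, neg_zero]; exact gaussianReal_Iio_ne_zero hv _)
  have hprob' : ∀ᶠ t : ℕ in atTop,
      c ≤ P {ω | M.totalValue (firstItems θ t ω) - t < -(K + 1) * √(t : ℝ)} := by
    filter_upwards [hprob, eventually_gt_atTop 0] with t h1 ht
    refine h1.trans (measure_mono fun ω hω => ?_)
    have hr : 0 < √(t : ℝ) := Real.sqrt_pos.2 (by exact_mod_cast ht)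
    have hω' : (√(t : ℝ))⁻¹ * (M.totalValue (firstItems θ t ω) - t) < -(K + 1) := hω
    rw [inv_mul_lt_iff₀ hr] at hω'
    simpa [mul_comm] using hω'
  refine ⟨hdeg, ?_, fun t => ?_, fun hcons => ?_, ?_⟩
  · simp only [hγ]
    exact AuctionMarket.tendstoInDistribution_multiplierOfMean hmean hθ_law hθ_indep
  · have hX : AEMeasurable (firstItems θ t) P :=
      aemeasurable_pi_iff.2 fun τ => (hθ_law τ).aemeasurable
    rw [hb]
    exact (M.measurable_bootstrapDeviation t).comp_aemeasurable
      (hX.prodMk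
        (aemeasurable_pi_iff.2 fun k => (hJ.uniform t k).aemeasurable))
  -- Consistency would make the event of distance at least `δ` eventually less likely than `c`, yet
  -- it contains the undershoot event up to a null set.
  · have hlim := tendstoInMeasure_iff_norm.1 hcons δ hδ
    obtain ⟨t, h1, h2, ht⟩ := ((hlim.eventually_lt_const (pos_iff_ne_zero.2 hc)).and
      (hprob'.and (eventually_gt_atTop 0))).exists
    refine absurd h1 (not_lt.2 (h2.trans (measure_mono_ae ?_)))
    filter_upwards [hfar] with ω hω hlt
    have hlt' : M.totalValue (firstItems θ t ω) - t < -(K + 1) * √(t : ℝ) := hlt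
    have := hω t ht (by nlinarith [Real.sqrt_nonneg (t : ℝ)])
    change δ ≤ ‖_ - (0 : ℝ)‖
    rw [sub_zero, hb]
    exact this.trans (le_abs_self _)
  · have hfreq := ae_frequently_sum_lt_mul_sqrt (P := P)
      (Y := fun k ω => M.value 0 (θ k ω) - 1) (a := -(K + 1)) (b := -K)
      (fun n => (AuctionMarket.aemeasurable_value hθ_law n).sub_const 1)
      ((AuctionMarket.iIndepFun_value hθ_indep).comp (fun _ x => x - 1) fun _ => by fun_prop)
      (by linarith) hc (by
        simpa [AuctionMarket.totalValue_firstItems, Finset.sum_sub_distrib] using hprob')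
    -- Undershoots recur infinitely often, each keeping the distance at least `δ`, whereas
    -- convergence would eventually push it below `δ`.
    filter_upwards [hfreq, hfar] with ω h1 h2 hlim
    obtain ⟨t, h3, h4, ht⟩ := (h1.and_eventually ((hlim.eventually_lt_const hδ).and
      (eventually_gt_atTop 0))).exists
    rw [hb] at h4
    refine absurd h4 (not_lt.2 (h2 t ht ?_))
    rw [AuctionMarket.totalValue_firstItems]
    simpa [Finset.sum_sub_distrib] using h3.le
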